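/- Let $(M,g)$ be a nonempty smooth Riemannian manifold of dimension $m\ge 2$, let $X^H,X^V$ denote the horizontal (with respect to the Levi-Civita connection) and vertical lifts to $TM$ of a tangent vector $X$, and for $u\in TM$ put $t=\tfrac12 g(u,u)$. Let $a,b:[0,\infty)\to\mathbb R$ be functions with $a(t)>0$ and $a(t)+2t\,b(t)>0$ for all $t\ge 0$ (for instance $a>0$, $b\ge0$), and let $\epsilon\in\{1,-1\}$. On $TM$ consider the Sasaki metric and its almost complex structure $$g_S(X^H,Y^H)=g_S(X^V,Y^V)=g(X,Y),\quad g_S(X^H,Y^V)=0,\qquad J_SX^H=X^V,\quad J_SX^V=-X^H,$$ and, at nonzero vectors $u$, the metric and almost complex structure $$g_A(X^H,Y^H)=g(X,Y),\quad g_A(X^H,Y^V)=0,\quad g_A(X^V,Y^V)=a\,g(X,Y)+b\,g(X,u)g(Y,u),$$ $$J_AX^H=\tfrac1{\sqrt a}X^V-\tfrac1{2t}\Big(\tfrac1{\sqrt a}+\tfrac{\epsilon}{\sqrt{a+2bt}}\Big)g(X,u)u^V,\qquad J_AX^V=-\sqrt a\,X^H+\tfrac1{2t}\big(\sqrt a+\epsilon\sqrt{a+2bt}\big)g(X,u)u^H,$$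 where $a=a(t)$, $b=b(t)$. For $r>0$ let $T_rM=\{v\in TM: g(v,v)=r^2\}$. On $T_rM$, regarded as a hypersurface of $(TM,g_S,J_S)$ with unit normal $N_r$ in the direction of $v^V$, let $\varphi_rU=\tan(J_SU)$ and $\xi_r=-J_SN_r$, where $\tan$ is the orthogonal projection onto the tangent spaces of $T_rM$; on $T_1M$, regarded as a hypersurface of $(TM,g_A,J_A)$, let $\varphi_A$ and $\xi_A$ be defined in the same way from $g_A$ and $J_A$. Let $F:T_1M\to T_rM$, $F(u)=ru$, and write $a_1=a(\tfrac12)$, the value of $a(t)$ on $T_1M$. Then: 1. $dF\circ\varphi_A=\varphi_r\circ dF$ on $T_1M$ if and only if $r=\sqrt{a_1}$. 2. For every $r>0$, $dF\circ\xi_A=-\epsilon\,\xi_r\circ F$ (so $\xi_A$ is mapped to $\xi_r$ if $\epsilon=-1$). If $r=\sqrt{a_1}$, then for both values of $\epsilon$ the characteristic vector field $-2\epsilon\sqrt{a_1}\,\xi_A$ of the normalised contact metric structure on $T_1M$ is mapped by $dF$ to the characteristic vector field $2r\,\xi_r$ of the normalised contact metric structure on $T_rM$. -/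

import Mathlib

open Bundle Set
open scoped Manifold ContDiff Topology

namespace TangentSphere

noncomputable section

set_option linter.unusedSectionVars false
set_option linter.unusedVariables false

variable {E : Type*} [NormedAddCommGroup E] [NormedSpace ℝ E] [FiniteDimensional ℝ E]
  {M : Type*} [TopologicalSpace M] [ChartedSpace E M] [IsManifold 𝓘(ℝ, E) ∞ M]

variable (E M) in
/-- A smooth Riemannian metric `g` on the (boundaryless) manifold `M` modelled on `E`. -/
abbrev Metric : Type _ :=
  ContMDiffRiemannianMetric 𝓘(ℝ, E) ∞ E (fun p : M ↦ TangentSpace 𝓘(ℝ, E) p)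

variable (E M) in
/-- The total space of the tangent bundle of `M`, as a manifold. Its preferred chart at `v` is the
natural chart `(xⁱ, yⁱ)` induced by the preferred chart of `M` at the base point of `v`. -/
abbrev TM : Type _ := TangentBundle 𝓘(ℝ, E) M

variable (E) in
/-- The tangent space `T_p M`. -/
abbrev T (p : M) : Type _ := TangentSpace 𝓘(ℝ, E) p

/-- The tangent space `T_v (T M)` of the manifold `T M` at `v`. As always in Mathlib it is identified
with the model space, here `E × E`, by the preferred chart at `v`: the pair `(X, Y)` is the vector
`Xⁱ ∂/∂xⁱ + Yⁱ ∂/∂yⁱ` in the natural coordinates `(xⁱ, yⁱ)`. -/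
abbrev TT (v : TM E M) : Type _ := TangentSpace (𝓘(ℝ, E).tangent) v

instance instFiniteDimensionalT (p : M) : FiniteDimensional ℝ (T E p) := inferInstanceAs (FiniteDimensional ℝ E)

/-- The metric in the preferred chart at `p`: `chartMetric g p x X Y = g_{ij}(x) Xⁱ Yʲ`. -/
def chartMetric (g : Metric E M) (p : M) (x : E) : E →L[ℝ] E →L[ℝ] ℝ :=
  let q : M := (extChartAt 𝓘(ℝ, E) p).symm x
  let L : E →L[ℝ] T E q := (trivializationAt E (TangentSpace 𝓘(ℝ, E)) p).symmL ℝ q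
  (ContinuousLinearMap.precomp ℝ L) ∘L (g.inner q) ∘L L

set_option synthInstance.maxHeartbeats 200000 in
/-- The derivative of the components of the metric at `p`:
`dChartMetric g p Z X Y = (∂_k g_{ij})(p) Zᵏ Xⁱ Yʲ`. -/
def dChartMetric (g : Metric E M) (p : M) : E →L[ℝ] E →L[ℝ] E →L[ℝ] ℝ :=
  fderiv ℝ (chartMetric g p) (extChartAt 𝓘(ℝ, E) p p)

/-- The inner product `g_p` as a bilinear form on `T_p M`. -/
def metricForm (g : Metric E M) (p : M) : LinearMap.BilinForm ℝ (T E p) :=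
  LinearMap.mk₂ ℝ (fun X Y ↦ g.inner p X Y) (by simp) (by simp) (by simp) (by simp)

theorem metricForm_nondegenerate (g : Metric E M) (p : M) : (metricForm g p).Nondegenerate := by
  have key : ∀ X : T E p, metricForm g p X X = 0 → X = 0 := fun X h ↦ by
    by_contra hX
    exact (g.pos p X hX).ne' h
  exact ⟨fun X h ↦ key X (h X), fun X h ↦ key X (h X)⟩

set_option synthInstance.maxHeartbeats 200000 in
set_option maxHeartbeats 1000000 in
/-- `(X, Y, Z) ↦ ½ (D X Y Z + D Y X Z - D Z X Y)`. -/
def koszul (D : E →L[ℝ] E →L[ℝ] E →L[ℝ] ℝ) : E →ₗ[ℝ] E →ₗ[ℝ] Module.Dual ℝ E :=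
  LinearMap.mk₂ ℝ
    (fun X Y ↦
      { toFun := fun Z ↦ (1 / 2 : ℝ) * (D X Y Z + D Y X Z - D Z X Y)
        map_add' := fun Z W ↦ by
          simp only [map_add, add_apply]; ring
        map_smul' := fun c Z ↦ by
          simp only [map_smul, smul_apply, smul_eq_mul, RingHom.id_apply]; ring })
    (fun X X' Y ↦ by
      ext Z
      simp only [map_add, add_apply, LinearMap.add_apply, LinearMap.coe_mk,
        AddHom.coe_mk]
      ring)
    (fun c X Y ↦ by
      ext Z
      simp only [map_smul, smul_apply, LinearMap.smul_apply, LinearMap.coe_mk,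
        AddHom.coe_mk, smul_eq_mul]
      ring)
    (fun X Y Y' ↦ by
      ext Z
      simp only [map_add, add_apply, LinearMap.add_apply, LinearMap.coe_mk,
        AddHom.coe_mk]
      ring)
    (fun c X Y ↦ by
      ext Z
      simp only [map_smul, smul_apply, LinearMap.smul_apply, LinearMap.coe_mk,
        AddHom.coe_mk, smul_eq_mul]
      ring)

/-- The Christoffel symbols of the first kind of the Levi-Civita connection of `g` at `p`:
`½ (∂_i g_{jk} + ∂_j g_{ik} - ∂_k g_{ij}) Xⁱ Yʲ Zᵏ`. -/
def christoffelLower (g : Metric E M) (p : M) : T E p →ₗ[ℝ] T E p →ₗ[ℝ] Module.Dual ℝ (T E p) :=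
  koszul (E := E) (dChartMetric g p)

/-- The Christoffel symbols `Γᵏ_{ij}` of the Levi-Civita connection of `g` at `p`, in the preferred
chart at `p`: `christoffel g p X Y` is the vector `Γᵏ_{ij} Xⁱ Yʲ ∂/∂xᵏ`. -/
def christoffel (g : Metric E M) (p : M) : T E p →ₗ[ℝ] T E p →ₗ[ℝ] T E p :=
  (christoffelLower g p).compr₂
    ((metricForm g p).toDual (metricForm_nondegenerate g p)).symm.toLinearMap

/-- The vertical lift `Yⱽ = Yᵏ ∂/∂yᵏ` at `v` of `Y ∈ T_p M`, `p` being the base point of `v`. -/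
def verticalLift (v : TM E M) : T E v.proj →ₗ[ℝ] TT v where
  toFun Y := ((0, Y) : E × E)
  map_add' Y Y' := Prod.ext (zero_add (0 : E)).symm rfl
  map_smul' c Y := Prod.ext (smul_zero c).symm rfl

/-- The horizontal lift `Xᴴ = Xⁱ (∂/∂xⁱ - Γᵏ_{ij} vʲ ∂/∂yᵏ)` at `v` of `X ∈ T_p M`, with respect to
the Levi-Civita connection of `g`. -/
def horizontalLift (g : Metric E M) (v : TM E M) : T E v.proj →ₗ[ℝ] TT v where
  toFun X := ((X, -christoffel g v.proj X v.snd) : E × E)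
  map_add' X X' := Prod.ext rfl (by
    change -christoffel g v.proj (X + X') v.snd =
      -christoffel g v.proj X v.snd + -christoffel g v.proj X' v.snd
    rw [map_add, LinearMap.add_apply, neg_add])
  map_smul' c X := Prod.ext rfl (by
    change -christoffel g v.proj (c • X) v.snd = c • -christoffel g v.proj X v.snd
    rw [map_smul, LinearMap.smul_apply, smul_neg])

/-- The differential of the projection `T M → M` at `v`. -/
def baseVelocity (v : TM E M) : TT v →ₗ[ℝ] T E v.proj where
  toFun W := (show E × E from W).1
  map_add' _ _ := rfl
  map_smul' _ _ := rfl

/-- The connection map (connector) of the Levi-Civita connection: the vertical part of `W` is the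
vertical lift of `connector g v W`, so `W = (baseVelocity v W)ᴴ + (connector g v W)ⱽ`. -/
def connector (g : Metric E M) (v : TM E M) : TT v →ₗ[ℝ] T E v.proj where
  toFun W := (show T E v.proj from (show E × E from W).2) + christoffel g v.proj (baseVelocity v W) v.snd
  map_add' W W' := by
    rw [map_add, map_add, LinearMap.add_apply]
    exact add_add_add_comm (G := E) _ _ _ _
  map_smul' c W := by
    rw [map_smul, map_smul, LinearMap.smul_apply]
    exact (smul_add (A := E) _ _ _).symm

/-- The function `v ↦ g(v, v)` on `T M`. -/
def normSq (g : Metric E M) (v : TM E M) : ℝ := g.inner v.proj v.snd v.snd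

/-- The tangent sphere bundle `T_r M = {v | g(v, v) = r²}`. -/
def sphereBundle (g : Metric E M) (r : ℝ) : Set (TM E M) := {v | normSq g v = r ^ 2}

/-- Scaling of tangent vectors `v ↦ r v`, as a map `T M → T M`. -/
def scale (r : ℝ) (v : TM E M) : TM E M := ⟨v.proj, r • v.snd⟩

/-- The tangent space at `v` of the tangent sphere bundle through `v` (the level set of
`w ↦ g(w, w)` that contains `v`): the kernel of the differential of `w ↦ g(w, w)` at `v`. -/
def sphereTangent (g : Metric E M) (v : TM E M) : Submodule ℝ (TT v) :=
  LinearMap.ker (mfderiv 𝓘(ℝ, E).tangent 𝓘(ℝ, ℝ) (normSq g) v).toLinearMap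

theorem contMDiff_normSq (g : Metric E M) : ContMDiff 𝓘(ℝ, E).tangent 𝓘(ℝ, ℝ) ∞ (normSq g) := by
  have h1 : ContMDiff 𝓘(ℝ, E).tangent 𝓘(ℝ, E) ∞ (fun v : TM E M ↦ v.proj) :=
    contMDiff_proj (TangentSpace 𝓘(ℝ, E))
  have h2 : ContMDiff 𝓘(ℝ, E).tangent (𝓘(ℝ, E).prod 𝓘(ℝ, E)) ∞
      (fun v : TM E M ↦ TotalSpace.mk' E (E := TangentSpace 𝓘(ℝ, E)) v.proj v.snd) :=
    contMDiff_id
  have h3 := g.contMDiff.comp h1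
  have := ContMDiff.clm_bundle_apply₂ (F₁ := E) (F₂ := E) (F₃ := ℝ) (E₃ := Bundle.Trivial M ℝ) h3 h2 h2
  intro v
  exact (contMDiffAt_totalSpace.1 (this v)).2

theorem contMDiff_scale (r : ℝ) :
    ContMDiff 𝓘(ℝ, E).tangent 𝓘(ℝ, E).tangent ∞ (scale r : TM E M → TM E M) := by
  intro v
  rw [contMDiffAt_totalSpace]
  refine ⟨contMDiff_proj (TangentSpace 𝓘(ℝ, E)) v, ?_⟩
  have h := (contMDiffAt_totalSpace.1 (contMDiffAt_id (I := 𝓘(ℝ, E).tangent) (n := ∞) (x := v))).2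
  have h0 : ContMDiffAt 𝓘(ℝ, E).tangent 𝓘(ℝ, ℝ) ∞ (fun _ : TM E M ↦ r) v := contMDiffAt_const
  refine (h0.smul h).congr_of_eventuallyEq ?_
  have hb : ∀ᶠ w : TM E M in 𝓝 v, w.proj ∈ (trivializationAt E (TangentSpace 𝓘(ℝ, E)) v.proj).baseSet :=
    (FiberBundle.continuous_proj E (TangentSpace 𝓘(ℝ, E))).continuousAt.preimage_mem_nhds
      ((trivializationAt E (TangentSpace 𝓘(ℝ, E)) v.proj).open_baseSet.mem_nhds
        (mem_baseSet_trivializationAt _ _ _))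
  filter_upwards [hb] with w hw
  exact ((trivializationAt E (TangentSpace 𝓘(ℝ, E)) v.proj).linear ℝ hw).map_smul r w.snd

theorem chartMetric_differentiableAt (g : Metric E M) (p : M) :
    DifferentiableAt ℝ (chartMetric g p) (extChartAt 𝓘(ℝ, E) p p) := by
  have h1 := ((contMDiffAt_hom_bundle _).1 (g.contMDiff p)).2
  have hsymm : ContMDiffAt 𝓘(ℝ, E) 𝓘(ℝ, E) ∞ (extChartAt 𝓘(ℝ, E) p).symm
      (extChartAt 𝓘(ℝ, E) p p) :=
    (contMDiffOn_extChartAt_symm p).contMDiffAt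
      ((isOpen_extChartAt_target p).mem_nhds (mem_extChartAt_target p))
  have hp : (extChartAt 𝓘(ℝ, E) p).symm (extChartAt 𝓘(ℝ, E) p p) = p := extChartAt_to_inv p
  have h2 := ContMDiffAt.comp (extChartAt 𝓘(ℝ, E) p p) (by rw [hp]; exact h1) hsymm
  refine (h2.contDiffAt.differentiableAt (by simp)).congr_of_eventuallyEq ?_
  have hb : ∀ᶠ x : E in 𝓝 (extChartAt 𝓘(ℝ, E) p p), (extChartAt 𝓘(ℝ, E) p).symm x ∈
      (trivializationAt E (TangentSpace 𝓘(ℝ, E)) p).baseSet := by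
    refine hsymm.continuousAt.preimage_mem_nhds
      ((trivializationAt E (TangentSpace 𝓘(ℝ, E)) p).open_baseSet.mem_nhds ?_)
    rw [hp]
    exact mem_baseSet_trivializationAt _ _ _
  filter_upwards [hb] with x hx
  ext X Y
  have key := inCoordinates_apply_eq₂ (𝕜 := ℝ) (F₁ := E) (E₁ := fun q : M ↦ TangentSpace 𝓘(ℝ, E) q)
    (F₂ := E) (E₂ := fun q : M ↦ TangentSpace 𝓘(ℝ, E) q) (F₃ := ℝ) (E₃ := Bundle.Trivial M ℝ)
    (x₀ := p) (ϕ := g.inner ((extChartAt 𝓘(ℝ, E) p).symm x)) (v := X) (w := Y) hx hx (by simp)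
  have e3 : ∀ c : ℝ, (trivializationAt ℝ (Bundle.Trivial M ℝ) p).linearMapAt ℝ
      ((extChartAt 𝓘(ℝ, E) p).symm x) c = c := fun c ↦ by simp
  rw [e3] at key
  have h5 : chartMetric g p x X Y = g.inner ((extChartAt 𝓘(ℝ, E) p).symm x)
     ((trivializationAt E (TangentSpace 𝓘(ℝ, E)) p).symmL ℝ _ X)
     ((trivializationAt E (TangentSpace 𝓘(ℝ, E)) p).symmL ℝ _ Y) := rfl
  rw [h5]
  refine Eq.trans ?_ (key.symm.trans ?_)
  · rw [Trivialization.symmL_apply _ hx, Trivialization.symmL_apply _ hx]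
  · rfl

theorem chartMetric_self (g : Metric E M) (p : M) (X Y : T E p) :
    chartMetric g p (extChartAt 𝓘(ℝ, E) p p) X Y = g.inner p X Y := by
  have hL : ∀ (q : M), q = p → ∀ X Y : E,
      g.inner q ((trivializationAt E (TangentSpace 𝓘(ℝ, E)) p).symmL ℝ q X)
      ((trivializationAt E (TangentSpace 𝓘(ℝ, E)) p).symmL ℝ q Y) = g.inner p (X : T E p) Y := by
    rintro q rfl X Y
    rw [TangentBundle.symmL_trivializationAt_eq_core (mem_chart_source E q)]
    have := fun X ↦ (tangentBundleCore 𝓘(ℝ, E) M).coordChange_self (achart E q) q (mem_chart_source E q) X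
    erw [this X, this Y]
  exact hL _ (extChartAt_to_inv p) X Y

theorem metricForm_christoffel (g : Metric E M) (p : M) (X Y Z : T E p) :
    g.inner p (christoffel g p X Y) Z = christoffelLower g p X Y Z :=
  LinearMap.BilinForm.apply_toDual_symm_apply (hB := metricForm_nondegenerate g p)
    (christoffelLower g p X Y) Z

theorem hasFDerivAt_quad {E : Type*} [NormedAddCommGroup E] [NormedSpace ℝ E] {G : Type*} [NormedAddCommGroup G] [NormedSpace ℝ G]
    (C : E → G)
    (D : E →L[ℝ] G) (z : E × E) (h : HasFDerivAt C D z.1) : HasFDerivAt (fun z : E × E ↦ C z.1)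
      (D ∘L ContinuousLinearMap.fst ℝ E E) z := by
  exact h.comp z (hasFDerivAt_fst (p := z))
set_option synthInstance.maxHeartbeats 200000 in
theorem hasFDerivAt_quad' {E : Type*} [NormedAddCommGroup E] [NormedSpace ℝ E]
    (C : E → E →L[ℝ] E →L[ℝ] ℝ)
    (D : E →L[ℝ] E →L[ℝ] E →L[ℝ] ℝ) (z : E × E) (h : HasFDerivAt C D z.1) :
    ∃ L : E × E →L[ℝ] ℝ, HasFDerivAt (fun z : E × E ↦ C z.1 z.2 z.2) L z ∧
      ∀ W, L W = D W.1 z.2 z.2 + C z.1 W.2 z.2 + C z.1 z.2 W.2 := by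
  have h01 : HasFDerivAt (fun z : E × E ↦ C z.1)
      (D ∘L ContinuousLinearMap.fst ℝ E E) z :=
    hasFDerivAt_quad C D z h
  have h02 : HasFDerivAt (fun z : E × E ↦ z.2) (ContinuousLinearMap.snd ℝ E E) z := hasFDerivAt_snd
  refine ⟨_, (h01.clm_apply h02).clm_apply h02, fun W ↦ ?_⟩
  simp
  ring

set_option synthInstance.maxHeartbeats 200000 in
theorem mfderiv_normSq (g : Metric E M) (v : TM E M) (W : TT v) :
    mfderiv 𝓘(ℝ, E).tangent 𝓘(ℝ, ℝ) (normSq g) v W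
      = 2 * g.inner v.proj (connector g v W) v.snd := by
  have hd : MDifferentiableAt 𝓘(ℝ, E).tangent 𝓘(ℝ, ℝ) (normSq g) v :=
    (contMDiff_normSq g).mdifferentiableAt (by simp)
  have h0 : HasFDerivAt (chartMetric g v.proj) (dChartMetric g v.proj)
      (extChartAt 𝓘(ℝ, E) v.proj v.proj) := (chartMetric_differentiableAt g v.proj).hasFDerivAt
  set z : E × E := extChartAt 𝓘(ℝ, E).tangent v v with hz
  have hz1 : z.1 = extChartAt 𝓘(ℝ, E) v.proj v.proj := rfl
  have hz2 : z.2 = v.snd := by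
    rw [hz, FiberBundle.extChartAt]
    exact (tangentBundleCore 𝓘(ℝ, E) M).coordChange_self (achart E v.proj) v.proj
      (mem_chart_source E v.proj) v.snd
  rw [← hz1] at h0
  obtain ⟨L, h1, hL⟩ := hasFDerivAt_quad' _ _ z h0
  have h2 : writtenInExtChartAt 𝓘(ℝ, E).tangent 𝓘(ℝ, ℝ) v (normSq g) =ᶠ[𝓝 z]
      (fun z : E × E ↦ chartMetric g v.proj z.1 z.2 z.2) := by
    have ht : ∀ᶠ y in 𝓝 z, y ∈ (extChartAt 𝓘(ℝ, E).tangent v).target := by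
      exact extChartAt_target_mem_nhds v
    filter_upwards [ht] with y hy
    simp only [writtenInExtChartAt, Function.comp]
    change normSq g ((extChartAt 𝓘(ℝ, E).tangent v).symm y) = _
    rw [FiberBundle.extChartAt_target] at hy
    have hy1 := hy.1.2
    have hy2 : (extChartAt 𝓘(ℝ, E).tangent v).symm y =
      TotalSpace.mk' E (E := TangentSpace 𝓘(ℝ, E)) ((extChartAt 𝓘(ℝ, E) v.proj).symm y.1)
        ((trivializationAt E (TangentSpace 𝓘(ℝ, E)) v.proj).symmL ℝ _ y.2) := by
      rw [FiberBundle.extChartAt, Trivialization.symmL_apply _ hy1]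
      exact ((trivializationAt E (TangentSpace 𝓘(ℝ, E)) v.proj).mk_symm hy1 y.2).symm
    rw [hy2]
    rfl
  have h3 := h1.congr_of_eventuallyEq h2
  have hr : range 𝓘(ℝ, E).tangent = univ := by simp
  have h4 : fderiv ℝ (writtenInExtChartAt 𝓘(ℝ, E).tangent 𝓘(ℝ, ℝ) v (normSq g)) z = L := h3.fderiv
  have e0 : ∀ X Y : T E v.proj, g.inner v.proj (Y + christoffel g v.proj X v.snd) v.snd =
      g.inner v.proj Y v.snd + christoffelLower g v.proj X v.snd v.snd := fun X Y ↦ by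
    rw [map_add, add_apply, metricForm_christoffel]
  have e1 : ∀ Y : E, chartMetric g v.proj z.1 Y z.2 = g.inner v.proj (Y : T E v.proj) v.snd :=
    fun Y ↦ by rw [hz1, hz2]; exact chartMetric_self g v.proj Y v.snd
  have e2 : ∀ Y : E, chartMetric g v.proj z.1 z.2 Y = g.inner v.proj (Y : T E v.proj) v.snd :=
    fun Y ↦ by
      rw [hz1, hz2]
      exact (chartMetric_self g v.proj v.snd Y).trans (g.symm _ _ _)
  have e3 : ∀ X : E, christoffelLower g v.proj (X : T E v.proj) v.snd v.snd =
      1 / 2 * (dChartMetric g v.proj X z.2 z.2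
        + dChartMetric g v.proj z.2 X z.2 - dChartMetric g v.proj z.2 X z.2) :=
    fun _ ↦ by rw [hz2]; rfl
  have hfin : ∀ X Y : E, L (X, Y) = 2 * (g.inner v.proj (Y : T E v.proj) v.snd +
      christoffelLower g v.proj (X : T E v.proj) v.snd v.snd) := fun X Y ↦ by
    rw [hL, e1, e2, e3]
    ring
  have h5 : mfderiv 𝓘(ℝ, E).tangent 𝓘(ℝ, ℝ) (normSq g) v W = L W := by
    have h6 : fderivWithin ℝ (writtenInExtChartAt 𝓘(ℝ, E).tangent 𝓘(ℝ, ℝ) v (normSq g))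
        (range 𝓘(ℝ, E).tangent) z = L := by rw [hr, fderivWithin_univ, h4]
    rw [hd.mfderiv]
    exact congr($h6 W)
  rw [h5]
  obtain ⟨X, Y⟩ : E × E := W
  exact (hfin X Y).trans congr(2 * $((e0 X Y).symm))

theorem mem_sphereTangent (g : Metric E M) (v : TM E M) (W : TT v) :
    W ∈ sphereTangent g v ↔ g.inner v.proj (connector g v W) v.snd = 0 := by
  have h : W ∈ sphereTangent g v ↔ mfderiv 𝓘(ℝ, E).tangent 𝓘(ℝ, ℝ) (normSq g) v W = 0 := Iff.rfl
  rw [h, mfderiv_normSq]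
  exact mul_eq_zero_iff_left (M₀ := ℝ) two_ne_zero

theorem connector_verticalLift (g : Metric E M) (v : TM E M) (Y : T E v.proj) :
    connector g v (verticalLift v Y) = Y := by
  change Y + christoffel g v.proj (0 : T E v.proj) v.snd = Y
  rw [map_zero, LinearMap.zero_apply, add_zero]

theorem connector_horizontalLift (g : Metric E M) (v : TM E M) (X : T E v.proj) :
    connector g v (horizontalLift g v X) = 0 :=
  neg_add_cancel (christoffel g v.proj X v.snd)

theorem baseVelocity_verticalLift (v : TM E M) (Y : T E v.proj) :
    baseVelocity v (verticalLift v Y) = 0 := rfl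

theorem baseVelocity_horizontalLift (g : Metric E M) (v : TM E M) (X : T E v.proj) :
    baseVelocity v (horizontalLift g v X) = X := rfl

/-- The energy density `t = ½ g(v, v)`. -/
def energy (g : Metric E M) (v : TM E M) : ℝ := normSq g v / 2

/-- The linear form `X ↦ g(X, v)`. -/
def flat (g : Metric E M) (v : TM E M) : T E v.proj →ₗ[ℝ] ℝ := metricForm g v.proj v.snd

/-- The Sasaki metric `g_S` on `T_v (T M)`: `g_S(Xᴴ, Yᴴ) = g_S(Xⱽ, Yⱽ) = g(X, Y)` and
`g_S(Xᴴ, Yⱽ) = 0`. -/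
def sasakiMetric (g : Metric E M) (v : TM E M) : LinearMap.BilinForm ℝ (TT v) :=
  (metricForm g v.proj).compl₁₂ (baseVelocity v) (baseVelocity v)
    + (metricForm g v.proj).compl₁₂ (connector g v) (connector g v)

/-- The almost complex structure `J_S Xᴴ = Xⱽ`, `J_S Xⱽ = -Xᴴ`. -/
def sasakiJ (g : Metric E M) (v : TM E M) : TT v →ₗ[ℝ] TT v :=
  verticalLift v ∘ₗ baseVelocity v - horizontalLift g v ∘ₗ connector g v

/-- The parameters of the general metric `g_A` and of the almost complex structure `J_A`: functions
`a`, `b` of the energy density `t ∈ [0, ∞)` and a sign `ε`. The two inequalities say exactly that `g_A`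
is positive definite; they hold in particular if `a > 0` and `b ≥ 0`. Values of `a` and `b` at negative
arguments are irrelevant. -/
structure Params where
  a : ℝ → ℝ
  b : ℝ → ℝ
  ε : ℝ
  a_pos : ∀ t, 0 ≤ t → 0 < a t
  a_add_pos : ∀ t, 0 ≤ t → 0 < a t + 2 * t * b t
  ε_eq : ε = 1 ∨ ε = -1

/-- The general metric `g_A` on `T_v (T M)`: `g_A(Xᴴ, Yᴴ) = g(X, Y)`, `g_A(Xᴴ, Yⱽ) = 0`,
`g_A(Xⱽ, Yⱽ) = a(t) g(X, Y) + b(t) g(X, v) g(Y, v)`. -/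
def metricA (g : Metric E M) (P : Params) (v : TM E M) : LinearMap.BilinForm ℝ (TT v) :=
  (metricForm g v.proj).compl₁₂ (baseVelocity v) (baseVelocity v)
    + P.a (energy g v) • (metricForm g v.proj).compl₁₂ (connector g v) (connector g v)
    + P.b (energy g v) •
      LinearMap.BilinForm.linMulLin (flat g v ∘ₗ connector g v) (flat g v ∘ₗ connector g v)

/-- The almost complex structure `J_A` at a nonzero vector `v`:
`J_A Xᴴ = (1/√a) Xⱽ - (1/2t) (1/√a + ε/√(a+2bt)) g(X, v) vⱽ`,
`J_A Xⱽ = -√a Xᴴ + (1/2t) (√a + ε √(a+2bt)) g(X, v) vᴴ`.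
(For `v = 0` the code uses the convention `1/0 = 0`; only vectors of positive length matter below.) -/
def JA (g : Metric E M) (P : Params) (v : TM E M) : TT v →ₗ[ℝ] TT v :=
  let t := energy g v
  let a := P.a t
  let b := P.b t
  verticalLift v ∘ₗ
      ((1 / √a) • LinearMap.id
        - (1 / (2 * t) * (1 / √a + P.ε * (1 / √(a + 2 * b * t)))) • (flat g v).smulRight v.snd) ∘ₗ
      baseVelocity v
    + horizontalLift g v ∘ₗ
      (-√a • LinearMap.id
        + (1 / (2 * t) * (√a + P.ε * √(a + 2 * b * t))) • (flat g v).smulRight v.snd) ∘ₗ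
      connector g v

/-- The outward unit normal, for the inner product `B` on `T_v (T M)`, of the tangent sphere bundle
through `v ≠ 0`: the vertical lift `vⱽ`, normalised (for `g_S` and `g_A`, `vⱽ` is orthogonal to the
tangent sphere bundle through `v`). -/
def unitNormal (v : TM E M) (B : LinearMap.BilinForm ℝ (TT v)) : TT v :=
  (1 / √(B (verticalLift v v.snd) (verticalLift v v.snd))) • verticalLift v v.snd

/-- The orthogonal projection `W ↦ W - B(W, N) N` of `T_v (T M)` onto the tangent space of the tangent
sphere bundle through `v`, where `N` is the unit normal. -/
def tangentialPart (v : TM E M) (B : LinearMap.BilinForm ℝ (TT v)) : TT v →ₗ[ℝ] TT v :=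
  LinearMap.id - (B.flip (unitNormal v B)).smulRight (unitNormal v B)

theorem normSq_nonneg (g : Metric E M) (v : TM E M) : 0 ≤ normSq g v := by
  by_cases h : v.snd = 0
  · simp [normSq, h]
  · exact (g.pos _ _ h).le

theorem sasakiMetric_verticalLift (g : Metric E M) (v : TM E M) (W : TT v) :
    sasakiMetric g v W (verticalLift v v.snd) = g.inner v.proj (connector g v W) v.snd := by
  change g.inner v.proj (baseVelocity v W) (baseVelocity v (verticalLift v v.snd)) +
    g.inner v.proj (connector g v W) (connector g v (verticalLift v v.snd)) = _
  rw [connector_verticalLift, baseVelocity_verticalLift, map_zero, zero_add]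

theorem metricA_verticalLift (g : Metric E M) (P : Params) (v : TM E M) (W : TT v) :
    metricA g P v W (verticalLift v v.snd)
      = (P.a (energy g v) + 2 * energy g v * P.b (energy g v))
        * g.inner v.proj (connector g v W) v.snd := by
  change g.inner v.proj (baseVelocity v W) (baseVelocity v (verticalLift v v.snd)) +
    P.a (energy g v) *
      g.inner v.proj (connector g v W) (connector g v (verticalLift v v.snd)) +
    P.b (energy g v) * (g.inner v.proj v.snd (connector g v W) *
      g.inner v.proj v.snd (connector g v (verticalLift v v.snd))) = _
  rw [connector_verticalLift, baseVelocity_verticalLift, map_zero, zero_add,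
    g.symm v.proj v.snd (connector g v W)]
  simp only [energy, normSq]
  ring

theorem tangentialPart_mem (g : Metric E M) (v : TM E M) (B : LinearMap.BilinForm ℝ (TT v)) (c : ℝ)
    (hc : 0 < c)
    (hB : ∀ W, B W (verticalLift v v.snd) = c * g.inner v.proj (connector g v W) v.snd)
    (W : TT v) : tangentialPart v B W ∈ sphereTangent g v := by
  rw [mem_sphereTangent]
  have h1 : tangentialPart v B W = W - B W (unitNormal v B) • unitNormal v B := rfl
  have h2 : B W (unitNormal v B) =
    (1 / √(B (verticalLift v v.snd) (verticalLift v v.snd))) * B W (verticalLift v v.snd) := by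
    rw [unitNormal, map_smul, smul_eq_mul]
  have h3 : g.inner v.proj (connector g v (unitNormal v B)) v.snd =
    (1 / √(B (verticalLift v v.snd) (verticalLift v v.snd))) * normSq g v := by
    rw [unitNormal, map_smul, map_smul, connector_verticalLift]
    rfl
  rw [h1, map_sub, map_smul, map_sub, map_smul, sub_apply,
    smul_apply, h3, h2, hB, hB, connector_verticalLift, smul_eq_mul]
  change _ - 1 / √(c * normSq g v) * _ * (1 / √(c * normSq g v) * normSq g v) = 0
  rcases (normSq_nonneg g v).eq_or_lt with h | h
  · have : v.snd = 0 := by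
      by_contra h'
      exact (g.pos _ _ h').ne h
    rw [← h, this]
    simp
  · have h5 : √(c * normSq g v) * √(c * normSq g v) = c * normSq g v :=
      Real.mul_self_sqrt (by positivity)
    have h6 : √(c * normSq g v) ≠ 0 := by positivity
    field_simp
    rw [pow_two, h5]
    ring

theorem sasakiMetric_tangentialPart_mem (g : Metric E M) (v : TM E M) (W : TT v) :
    tangentialPart v (sasakiMetric g v) W ∈ sphereTangent g v :=
  tangentialPart_mem g v _ 1 one_pos (fun W ↦ by rw [sasakiMetric_verticalLift, one_mul]) W

theorem metricA_tangentialPart_mem (g : Metric E M) (P : Params) (v : TM E M) (W : TT v) :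
    tangentialPart v (metricA g P v) W ∈ sphereTangent g v :=
  tangentialPart_mem g v _ _ (P.a_add_pos _ (div_nonneg (normSq_nonneg g v) two_pos.le))
    (metricA_verticalLift g P v) W

/-- The tensor `φ_A U = tan(J_A U)` induced by `(g_A, J_A)` on the tangent sphere bundle. -/
def phiA (g : Metric E M) (P : Params) (v : TM E M) :
    sphereTangent g v →ₗ[ℝ] sphereTangent g v :=
  (tangentialPart v (metricA g P v) ∘ₗ JA g P v ∘ₗ (sphereTangent g v).subtype).codRestrict _
    fun _ ↦ metricA_tangentialPart_mem g P v _

/-- The tensor `φ_r U = tan(J_S U)` induced by `(g_S, J_S)` on the tangent sphere bundle `T_r M` at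
`v ∈ T_r M`. -/
def phiS (g : Metric E M) (v : TM E M) : sphereTangent g v →ₗ[ℝ] sphereTangent g v :=
  (tangentialPart v (sasakiMetric g v) ∘ₗ sasakiJ g v ∘ₗ (sphereTangent g v).subtype).codRestrict _
    fun _ ↦ sasakiMetric_tangentialPart_mem g v _

theorem sasaki_xi_mem (g : Metric E M) (v : TM E M) :
    -sasakiJ g v (unitNormal v (sasakiMetric g v)) ∈ sphereTangent g v := by
  refine (sphereTangent g v).neg_mem ?_
  rw [unitNormal, map_smul]
  refine (sphereTangent g v).smul_mem _ ?_
  rw [mem_sphereTangent]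
  have : sasakiJ g v (verticalLift v v.snd) = verticalLift v (baseVelocity v (verticalLift v v.snd))
    - horizontalLift g v (connector g v (verticalLift v v.snd)) := rfl
  rw [this, map_sub, connector_horizontalLift, connector_verticalLift,
    baseVelocity_verticalLift, sub_zero, map_zero]
  rfl

theorem metricA_xi_mem (g : Metric E M) (P : Params) (v : TM E M) :
    -JA g P v (unitNormal v (metricA g P v)) ∈ sphereTangent g v := by
  refine (sphereTangent g v).neg_mem ?_
  rw [unitNormal, map_smul]
  refine (sphereTangent g v).smul_mem _ ?_
  rw [mem_sphereTangent, JA, LinearMap.add_apply, LinearMap.comp_apply, LinearMap.comp_apply,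
    LinearMap.comp_apply, LinearMap.comp_apply, map_add, connector_horizontalLift,
    connector_verticalLift, baseVelocity_verticalLift, map_zero, add_zero, map_zero]
  rfl

/-- The characteristic vector `ξ_A = -J_A N` induced by `(g_A, J_A)`. -/
def xiA (g : Metric E M) (P : Params) (v : TM E M) : sphereTangent g v :=
  ⟨-JA g P v (unitNormal v (metricA g P v)), metricA_xi_mem g P v⟩

/-- The characteristic vector `ξ_r = -J_S N` induced by `(g_S, J_S)` on `T_r M` at `v ∈ T_r M`. -/
def xiS (g : Metric E M) (v : TM E M) : sphereTangent g v :=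
  ⟨-sasakiJ g v (unitNormal v (sasakiMetric g v)), sasaki_xi_mem g v⟩

/-- The map `F : T_1 M → T_r M`, `u ↦ r u`. -/
def sphereMap (g : Metric E M) (r : ℝ) (u : sphereBundle g 1) : sphereBundle g r :=
  ⟨scale r u.1, by
    have h : normSq g u.1 = 1 ^ 2 := u.2
    have h' : normSq g (scale r u.1) = r * (r * normSq g u.1) := by
      change g.inner u.1.proj (r • u.1.snd) (r • u.1.snd) = _
      rw [map_smul, map_smul, smul_apply]
      rfl
    change normSq g (scale r u.1) = r ^ 2
    rw [h', h]
    ring⟩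

theorem normSq_scale (g : Metric E M) (r : ℝ) (v : TM E M) :
    normSq g (scale r v) = r ^ 2 * normSq g v := by
  have h' : normSq g (scale r v) = r * (r * normSq g v) := by
    change g.inner v.proj (r • v.snd) (r • v.snd) = _
    rw [map_smul, map_smul, smul_apply]
    rfl
  rw [h']
  ring

theorem mfderiv_scale_mem (g : Metric E M) (r : ℝ) (v : TM E M) (W : TT v)
    (hW : W ∈ sphereTangent g v) :
    mfderiv 𝓘(ℝ, E).tangent 𝓘(ℝ, E).tangent (scale r) v W ∈ sphereTangent g (scale r v) := by
  have hd : ∀ w, MDifferentiableAt 𝓘(ℝ, E).tangent 𝓘(ℝ, ℝ) (normSq g) w :=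
    fun w ↦ (contMDiff_normSq g).mdifferentiableAt (by simp)
  have hs : MDifferentiableAt 𝓘(ℝ, E).tangent 𝓘(ℝ, E).tangent (scale r) v :=
    (contMDiff_scale r).mdifferentiableAt (by simp)
  have h1 := mfderiv_comp v (hd (scale r v)) hs
  have h2 : normSq g ∘ scale r = (r ^ 2) • normSq g := funext fun w ↦ normSq_scale g r w
  rw [h2, const_smul_mfderiv (hd v)] at h1
  have h3 := congr($h1 W)
  have hW' : mfderiv 𝓘(ℝ, E).tangent 𝓘(ℝ, ℝ) (normSq g) v W = 0 := hW
  have h4 : ((r ^ 2) • mfderiv 𝓘(ℝ, E).tangent 𝓘(ℝ, ℝ) (normSq g) v) W = 0 :=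
    congr((r ^ 2 : ℝ) • $hW').trans (smul_zero (A := ℝ) _)
  exact h3.symm.trans h4

/-- The differential `dF` of `F : T_1 M → T_r M` at `u`: the restriction of the differential of
`v ↦ r v` to the tangent spaces of the sphere bundles. -/
def dSphereMap (g : Metric E M) (r : ℝ) (u : sphereBundle g 1) :
    sphereTangent g u.1 →ₗ[ℝ] sphereTangent g (sphereMap g r u).1 :=
  LinearMap.restrict
    (mfderiv 𝓘(ℝ, E).tangent 𝓘(ℝ, E).tangent (scale r) u.1).toLinearMap
    fun W hW ↦ mfderiv_scale_mem g r u.1 W hW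

/-- The characteristic vector of the contact metric structure on `T_1 M` obtained by normalising the
almost contact metric structure induced by `(g_A, J_A)`: `-2 ε √a ξ_A`, with `a = a(½)`. -/
def contactXiA (g : Metric E M) (P : Params) (u : TM E M) : sphereTangent g u :=
  (-2 * P.ε * √(P.a (1 / 2))) • xiA g P u

/-- The characteristic vector of the contact metric structure on `T_r M` obtained by normalising the
almost contact metric structure induced by `(g_S, J_S)`: `2 r ξ_r`. -/
def contactXiS (g : Metric E M) (r : ℝ) (v : TM E M) : sphereTangent g v :=
  (2 * r) • xiS g v

end

end TangentSphere

namespace TangentSphere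

noncomputable section

set_option linter.unusedSectionVars false

variable {E : Type*} [NormedAddCommGroup E] [NormedSpace ℝ E] [FiniteDimensional ℝ E]
  {M : Type*} [TopologicalSpace M] [ChartedSpace E M] [IsManifold 𝓘(ℝ, E) ∞ M]

/-! A vector of `T_v(TM)` is a pair (X, Y) of vectors of the fibre: its base velocity and its
connector. In these terms every map involved is explicit. Scaling has differential (X, Y) ↦ (X, rY),
because the Christoffel term is linear in the fibre vector. Tangency to the sphere bundle means g(Y,
u) = 0.

On unit vectors 2t = 1. The correction term of J_A along u in the horizontal part vanishes by
tangency, and the one in the vertical part is removed by the projection. Hence b and ε drop out, and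
φ_A is (X, Y) ↦ (-√a Y, (X - g(X, u)u)/√a). At ru, φ_r is (X, Y) ↦ (-Y, X - g(X, u)u). So dF∘φ_A and
φ_r∘dF send (X, Y) to (-√a Y, (r/√a)(X - g(X, u)u)) and (-rY, X - g(X, u)u). They agree if r = √a
(`dSphereMap_phiA`); conversely a single nonzero Y orthogonal to u forces r = √a
(`eq_of_dSphereMap_phiA`), and dimension at least 2 supplies one.

For the characteristic vectors the correction term is what matters: ξ_A is (-εu, 0), while ξ_r at ru
is (u, 0), and dF fixes horizontal components (`dSphereMap_xiA`). -/

/-! ### The differential of scaling and the horizontal-vertical splitting -/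

/-- In natural coordinates scaling is the restriction of a linear map, which is therefore its own
derivative. -/
theorem mfderiv_scale (r : ℝ) (v : TM E M) (W : TT v) :
    mfderiv 𝓘(ℝ, E).tangent 𝓘(ℝ, E).tangent (scale r) v W =
      ((show E × E from W).1, r • (show E × E from W).2) := by
  have hs : MDifferentiableAt 𝓘(ℝ, E).tangent 𝓘(ℝ, E).tangent (scale r) v :=
    (contMDiff_scale r).mdifferentiableAt (by simp)
  set z : E × E := extChartAt 𝓘(ℝ, E).tangent v v with hz
  let L : E × E →L[ℝ] E × E :=
    (ContinuousLinearMap.fst ℝ E E).prod (r • ContinuousLinearMap.snd ℝ E E)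
  have h2 : writtenInExtChartAt 𝓘(ℝ, E).tangent 𝓘(ℝ, E).tangent v (scale r) =ᶠ[𝓝 z] L := by
    filter_upwards [extChartAt_target_mem_nhds (I := 𝓘(ℝ, E).tangent) v] with y hy
    have hy' := hy
    rw [FiberBundle.extChartAt_target] at hy'
    have hy1 := hy'.1.2
    have hy2 : (extChartAt 𝓘(ℝ, E).tangent v).symm y =
      TotalSpace.mk' E (E := TangentSpace 𝓘(ℝ, E)) ((extChartAt 𝓘(ℝ, E) v.proj).symm y.1)
        ((trivializationAt E (TangentSpace 𝓘(ℝ, E)) v.proj).symmL ℝ _ y.2) := by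
      rw [FiberBundle.extChartAt, Trivialization.symmL_apply _ hy1]
      exact ((trivializationAt E (TangentSpace 𝓘(ℝ, E)) v.proj).mk_symm hy1 y.2).symm
    have hy3 : scale r ((extChartAt 𝓘(ℝ, E).tangent v).symm y) =
        (extChartAt 𝓘(ℝ, E).tangent v).symm (y.1, r • y.2) := by
      have hy4 : (extChartAt 𝓘(ℝ, E).tangent v).symm (y.1, r • y.2) =
        TotalSpace.mk' E (E := TangentSpace 𝓘(ℝ, E)) ((extChartAt 𝓘(ℝ, E) v.proj).symm y.1)
          ((trivializationAt E (TangentSpace 𝓘(ℝ, E)) v.proj).symmL ℝ _ (r • y.2)) := by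
        rw [FiberBundle.extChartAt, Trivialization.symmL_apply _ hy1]
        exact ((trivializationAt E (TangentSpace 𝓘(ℝ, E)) v.proj).mk_symm hy1 (r • y.2)).symm
      rw [hy4, hy2, map_smul]
      rfl
    -- The chart target is a product with the whole fibre, so rescaling the second coordinate stays
    -- inside it.
    have hy5 : ((y.1, r • y.2) : E × E) ∈ (extChartAt 𝓘(ℝ, E).tangent v).target := by
      rw [FiberBundle.extChartAt_target]
      exact ⟨hy'.1, mem_univ _⟩
    -- The preferred chart of `TM` depends only on the base point, so the charts at `v` and at
    -- `scale r v` coincide.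
    change extChartAt 𝓘(ℝ, E).tangent v (scale r ((extChartAt 𝓘(ℝ, E).tangent v).symm y)) = _
    rw [hy3]
    exact (extChartAt 𝓘(ℝ, E).tangent v).right_inv hy5
  have h4 : fderivWithin ℝ (writtenInExtChartAt 𝓘(ℝ, E).tangent 𝓘(ℝ, E).tangent v (scale r))
      (range 𝓘(ℝ, E).tangent) z = L := by
    have hr : range 𝓘(ℝ, E).tangent = univ := by simp
    rw [hr, fderivWithin_univ]
    exact (L.hasFDerivAt.congr_of_eventuallyEq h2).fderiv
  rw [hs.mfderiv]
  exact congr($h4 W)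

theorem baseVelocity_mfderiv_scale (r : ℝ) (v : TM E M) (W : TT v) :
    baseVelocity (scale r v) (mfderiv 𝓘(ℝ, E).tangent 𝓘(ℝ, E).tangent (scale r) v W) =
      baseVelocity v W := by
  rw [mfderiv_scale]
  rfl

theorem connector_mfderiv_scale (g : Metric E M) (r : ℝ) (v : TM E M) (W : TT v) :
    connector g (scale r v) (mfderiv 𝓘(ℝ, E).tangent 𝓘(ℝ, E).tangent (scale r) v W) =
      r • connector g v W := by
  rw [mfderiv_scale]
  change r • (show T E v.proj from (show E × E from W).2) +
      christoffel g v.proj (baseVelocity v W) (r • v.snd) =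
    r • ((show T E v.proj from (show E × E from W).2) +
      christoffel g v.proj (baseVelocity v W) v.snd)
  rw [map_smul, smul_add]

/-- The map W ↦ (X, Y) is a shear of the coordinate pair, hence injective; identities between
tangent vectors can be checked on the two components. -/
theorem ext_baseVelocity_connector (g : Metric E M) {v : TM E M} {W W' : TT v}
    (h₁ : baseVelocity v W = baseVelocity v W') (h₂ : connector g v W = connector g v W') :
    W = W' := by
  refine Prod.ext h₁ ?_
  change (show T E v.proj from (show E × E from W).2) +
      christoffel g v.proj (baseVelocity v W) v.snd =
    (show T E v.proj from (show E × E from W').2) +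
      christoffel g v.proj (baseVelocity v W') v.snd at h₂
  rw [h₁] at h₂
  exact add_right_cancel (G := T E v.proj) h₂

/-! ### Unit normals, almost complex structures and projections in components -/

theorem normSq_sphereBundle (g : Metric E M) {r : ℝ} (v : sphereBundle g r) :
    g.inner v.1.proj v.1.snd v.1.snd = r ^ 2 := v.2

theorem energy_sphereBundle_one (g : Metric E M) (u : sphereBundle g 1) :
    energy g u.1 = 1 / 2 := by
  have h : normSq g u.1 = 1 ^ 2 := u.2
  rw [energy, h]
  norm_num

theorem unitNormal_sasaki (g : Metric E M) {r : ℝ} (hr : 0 < r) (v : sphereBundle g r) :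
    unitNormal v.1 (sasakiMetric g v.1) = (1 / r) • verticalLift v.1 v.1.snd := by
  rw [unitNormal, sasakiMetric_verticalLift, connector_verticalLift, normSq_sphereBundle,
    Real.sqrt_sq hr.le]

/-- At t = 1/2 the squared g_A-length of the vertical lift of u is a + 2tb = a + b. -/
theorem unitNormal_metricA (g : Metric E M) (P : Params) (u : sphereBundle g 1) :
    unitNormal u.1 (metricA g P u.1) =
      (1 / √(P.a (1 / 2) + P.b (1 / 2))) • verticalLift u.1 u.1.snd := by
  rw [unitNormal, metricA_verticalLift, connector_verticalLift, normSq_sphereBundle,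
    energy_sphereBundle_one]
  norm_num

theorem baseVelocity_sasakiJ (g : Metric E M) (v : TM E M) (W : TT v) :
    baseVelocity v (sasakiJ g v W) = -connector g v W := by
  change baseVelocity v (verticalLift v (baseVelocity v W) - horizontalLift g v (connector g v W)) = _
  rw [map_sub, baseVelocity_verticalLift, baseVelocity_horizontalLift, zero_sub]

theorem connector_sasakiJ (g : Metric E M) (v : TM E M) (W : TT v) :
    connector g v (sasakiJ g v W) = baseVelocity v W := by
  change connector g v (verticalLift v (baseVelocity v W) - horizontalLift g v (connector g v W)) = _
  rw [map_sub, connector_verticalLift, connector_horizontalLift, sub_zero]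

theorem JA_apply (g : Metric E M) (P : Params) (u : sphereBundle g 1) (W : TT u.1) :
    JA g P u.1 W =
      verticalLift u.1 ((1 / √(P.a (1 / 2))) • baseVelocity u.1 W
        - (1 / √(P.a (1 / 2)) + P.ε * (1 / √(P.a (1 / 2) + P.b (1 / 2)))) •
          (g.inner u.1.proj u.1.snd (baseVelocity u.1 W)) • u.1.snd)
      + horizontalLift g u.1 (-√(P.a (1 / 2)) • connector g u.1 W
        + (√(P.a (1 / 2)) + P.ε * √(P.a (1 / 2) + P.b (1 / 2))) •
          (g.inner u.1.proj u.1.snd (connector g u.1 W)) • u.1.snd) := by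
  rw [JA, energy_sphereBundle_one]
  have h1 : 2 * P.b (1 / 2) * (1 / 2) = P.b (1 / 2) := by ring
  have h2 : (1 : ℝ) / (2 * (1 / 2)) = 1 := by norm_num
  simp only [h1, h2, one_mul]
  rfl

theorem baseVelocity_JA (g : Metric E M) (P : Params) (u : sphereBundle g 1) (W : TT u.1) :
    baseVelocity u.1 (JA g P u.1 W) = -√(P.a (1 / 2)) • connector g u.1 W
        + (√(P.a (1 / 2)) + P.ε * √(P.a (1 / 2) + P.b (1 / 2))) •
          (g.inner u.1.proj u.1.snd (connector g u.1 W)) • u.1.snd := by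
  rw [JA_apply, map_add, baseVelocity_verticalLift, baseVelocity_horizontalLift, zero_add]

theorem connector_JA (g : Metric E M) (P : Params) (u : sphereBundle g 1) (W : TT u.1) :
    connector g u.1 (JA g P u.1 W) = (1 / √(P.a (1 / 2))) • baseVelocity u.1 W
        - (1 / √(P.a (1 / 2)) + P.ε * (1 / √(P.a (1 / 2) + P.b (1 / 2)))) •
          (g.inner u.1.proj u.1.snd (baseVelocity u.1 W)) • u.1.snd := by
  rw [JA_apply, map_add, connector_verticalLift, connector_horizontalLift, add_zero]

theorem tangentialPart_apply (v : TM E M) (B : LinearMap.BilinForm ℝ (TT v)) (W : TT v) :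
    tangentialPart v B W = W - B W (unitNormal v B) • unitNormal v B := rfl

/-- The normal is vertical, so the projection changes only the vertical component. -/
theorem baseVelocity_tangentialPart (v : TM E M) (B : LinearMap.BilinForm ℝ (TT v)) (W : TT v) :
    baseVelocity v (tangentialPart v B W) = baseVelocity v W := by
  rw [tangentialPart_apply, unitNormal, map_sub, map_smul, map_smul (baseVelocity v),
    baseVelocity_verticalLift, smul_zero, smul_zero, sub_zero]

theorem connector_tangentialPart_sasaki (g : Metric E M) {r : ℝ} (hr : 0 < r)
    (v : sphereBundle g r) (W : TT v.1) :
    connector g v.1 (tangentialPart v.1 (sasakiMetric g v.1) W) = connector g v.1 W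
      - ((1 / r) ^ 2 * g.inner v.1.proj (connector g v.1 W) v.1.snd) • v.1.snd := by
  rw [tangentialPart_apply, unitNormal_sasaki g hr, map_sub, map_smul, map_smul, map_smul,
    connector_verticalLift, sasakiMetric_verticalLift, smul_smul, smul_eq_mul]
  congr 2
  ring

/-- Pairing with the vertical lift of u produces a factor a + b, which cancels the squared
normalisation of the normal. What remains is the g-orthogonal projection along u, independent of a
and b. -/
theorem connector_tangentialPart_metricA (g : Metric E M) (P : Params)
    (u : sphereBundle g 1) (W : TT u.1) :
    connector g u.1 (tangentialPart u.1 (metricA g P u.1) W) = connector g u.1 W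
      - (g.inner u.1.proj (connector g u.1 W) u.1.snd) • u.1.snd := by
  rw [tangentialPart_apply, unitNormal_metricA g, map_sub, map_smul, map_smul, map_smul,
    connector_verticalLift, metricA_verticalLift, smul_smul, smul_eq_mul, energy_sphereBundle_one]
  congr 2
  have h0 : 0 < P.a (1 / 2) + P.b (1 / 2) := by
    have := P.a_add_pos (1 / 2) (by norm_num)
    norm_num at this ⊢
    exact this
  have h1 : √(P.a (1 / 2) + P.b (1 / 2)) * √(P.a (1 / 2) + P.b (1 / 2)) =
    P.a (1 / 2) + P.b (1 / 2) := Real.mul_self_sqrt h0.le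
  have h2 : √(P.a (1 / 2) + P.b (1 / 2)) ≠ 0 := (Real.sqrt_pos.2 h0).ne'
  field_simp
  rw [pow_two, h1]

/-! ### The tensors φ_A and φ_r -/

theorem baseVelocity_phiA (g : Metric E M) (P : Params) (u : sphereBundle g 1)
    (W : sphereTangent g u.1) :
    baseVelocity u.1 (phiA g P u.1 W : TT u.1) = -√(P.a (1 / 2)) • connector g u.1 W := by
  have h := (mem_sphereTangent g u.1 W).1 W.2
  rw [g.symm] at h
  change baseVelocity u.1 (tangentialPart u.1 (metricA g P u.1) (JA g P u.1 W)) = _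
  -- Tangency `h` annihilates the term containing ε.
  rw [baseVelocity_tangentialPart, baseVelocity_JA, h, zero_smul, smul_zero, add_zero]

/-- The vertical correction term of J_A is a multiple of the unit vector u, and the projection along
u removes it. -/
theorem connector_phiA (g : Metric E M) (P : Params) (u : sphereBundle g 1)
    (W : sphereTangent g u.1) :
    connector g u.1 (phiA g P u.1 W : TT u.1) = (1 / √(P.a (1 / 2))) •
      (baseVelocity u.1 W - g.inner u.1.proj (baseVelocity u.1 W) u.1.snd • u.1.snd) := by
  change connector g u.1 (tangentialPart u.1 (metricA g P u.1) (JA g P u.1 W)) = _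
  rw [connector_tangentialPart_metricA, connector_JA, map_sub, map_smul, map_smul, map_smul,
    sub_apply, smul_apply, smul_apply, smul_apply, normSq_sphereBundle,
    g.symm u.1.proj u.1.snd]
  simp only [smul_eq_mul]
  module

theorem baseVelocity_phiS (g : Metric E M) (v : TM E M) (W : sphereTangent g v) :
    baseVelocity v (phiS g v W : TT v) = -connector g v W := by
  change baseVelocity v (tangentialPart v (sasakiMetric g v) (sasakiJ g v W)) = _
  rw [baseVelocity_tangentialPart, baseVelocity_sasakiJ]

theorem connector_phiS (g : Metric E M) {r : ℝ} (hr : 0 < r) (v : sphereBundle g r)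
    (W : sphereTangent g v.1) :
    connector g v.1 (phiS g v.1 W : TT v.1) = baseVelocity v.1 W
      - ((1 / r) ^ 2 * g.inner v.1.proj (baseVelocity v.1 W) v.1.snd) • v.1.snd := by
  change connector g v.1 (tangentialPart v.1 (sasakiMetric g v.1) (sasakiJ g v.1 W)) = _
  rw [connector_tangentialPart_sasaki g hr, connector_sasakiJ]

/-! ### Comparison of φ_A and φ_r under dF -/

theorem baseVelocity_dSphereMap (g : Metric E M) (r : ℝ) (u : sphereBundle g 1)
    (W : sphereTangent g u.1) :
    baseVelocity (sphereMap g r u).1 (dSphereMap g r u W : TT (sphereMap g r u).1) =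
      baseVelocity u.1 W :=
  baseVelocity_mfderiv_scale r u.1 W

theorem connector_dSphereMap (g : Metric E M) (r : ℝ) (u : sphereBundle g 1)
    (W : sphereTangent g u.1) :
    connector g (sphereMap g r u).1 (dSphereMap g r u W : TT (sphereMap g r u).1) =
      r • connector g u.1 W :=
  connector_mfderiv_scale g r u.1 W

theorem connector_phiS_dSphereMap (g : Metric E M) {r : ℝ} (hr : 0 < r) (u : sphereBundle g 1)
    (W : sphereTangent g u.1) :
    connector g (sphereMap g r u).1
        (phiS g (sphereMap g r u).1 (dSphereMap g r u W) : TT (sphereMap g r u).1) =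
      (baseVelocity u.1 W - g.inner u.1.proj (baseVelocity u.1 W) u.1.snd • u.1.snd :
        T E u.1.proj) := by
  -- The factor (1/r)² absorbs the two factors r coming from the base vector ru.
  have key : ∀ X w : T E u.1.proj,
      X - ((1 / r) ^ 2 * g.inner u.1.proj X (r • w)) • (r • w) =
        X - g.inner u.1.proj X w • w := fun X w ↦ by
    rw [map_smul, smul_smul, smul_eq_mul]
    congr 2
    field_simp
  rw [connector_phiS g hr (sphereMap g r u), baseVelocity_dSphereMap]
  exact key (baseVelocity u.1 W) u.1.snd

theorem dSphereMap_phiA (g : Metric E M) (P : Params) (u : sphereBundle g 1) :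
    dSphereMap g √(P.a (1 / 2)) u ∘ₗ phiA g P u =
      phiS g (sphereMap g √(P.a (1 / 2)) u) ∘ₗ dSphereMap g √(P.a (1 / 2)) u := by
  have hr : 0 < √(P.a (1 / 2)) := Real.sqrt_pos.2 (P.a_pos _ (by norm_num))
  refine LinearMap.ext fun W ↦ Subtype.ext (ext_baseVelocity_connector g ?_ ?_)
  · rw [LinearMap.comp_apply, LinearMap.comp_apply, baseVelocity_dSphereMap, baseVelocity_phiA,
      baseVelocity_phiS, connector_dSphereMap, neg_smul]
    rfl
  · rw [LinearMap.comp_apply, LinearMap.comp_apply, connector_dSphereMap, connector_phiA,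
      connector_phiS_dSphereMap g hr, smul_smul, mul_one_div_cancel hr.ne']
    exact one_smul ℝ _

/-- Tested on the vertical lift of Y, the two sides have horizontal components -√a Y and -rY. -/
theorem eq_of_dSphereMap_phiA {g : Metric E M} {P : Params} {r : ℝ} {u : sphereBundle g 1}
    (h : dSphereMap g r u ∘ₗ phiA g P u = phiS g (sphereMap g r u) ∘ₗ dSphereMap g r u)
    {Y : T E u.1.proj} (hY : Y ≠ 0) (hYu : g.inner u.1.proj Y u.1.snd = 0) :
    r = √(P.a (1 / 2)) := by
  let W : sphereTangent g u.1 := ⟨verticalLift u.1 Y, by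
    rw [mem_sphereTangent, connector_verticalLift, hYu]⟩
  have h1 : baseVelocity (sphereMap g r u).1 (dSphereMap g r u (phiA g P u W)).1 =
      baseVelocity (sphereMap g r u).1 (phiS g (sphereMap g r u) (dSphereMap g r u W)).1 :=
    congr(baseVelocity _ (($h W).1))
  rw [baseVelocity_dSphereMap, baseVelocity_phiA, baseVelocity_phiS, connector_dSphereMap,
    connector_verticalLift] at h1
  have h2 : (r - √(P.a (1 / 2))) • Y = 0 := by
    -- The fibres at u and ru are the same space, so `h1` can be read at u.
    have h3 : -√(P.a (1 / 2)) • Y = -(r • Y) := h1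
    rw [sub_smul, ← sub_eq_zero.2 h3]
    module
  exact sub_eq_zero.1 ((smul_eq_zero.1 h2).resolve_right hY)

theorem exists_sphereBundle_one_orthogonal (hdim : 2 ≤ Module.finrank ℝ E) [Nonempty M]
    (g : Metric E M) : ∃ u : sphereBundle g 1, ∃ Y : T E u.1.proj,
      Y ≠ 0 ∧ g.inner u.1.proj Y u.1.snd = 0 := by
  obtain ⟨p⟩ := ‹Nonempty M›
  have hfr : Module.finrank ℝ (T E p) = Module.finrank ℝ E := rfl
  have : Nontrivial (T E p) := Module.nontrivial_of_finrank_pos (R := ℝ) (by omega)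
  obtain ⟨X, hX⟩ := exists_ne (0 : T E p)
  have hpos := g.pos p X hX
  have hmem : normSq g (⟨p, (1 / √(g.inner p X X)) • X⟩ : TM E M) = 1 ^ 2 := by
    change g.inner p ((1 / √(g.inner p X X)) • X) ((1 / √(g.inner p X X)) • X) = _
    rw [map_smul, map_smul, smul_apply, smul_eq_mul, smul_eq_mul]
    have h1 := Real.mul_self_sqrt hpos.le
    have h2 : √(g.inner p X X) ≠ 0 := (Real.sqrt_pos.2 hpos).ne'
    field_simp
    rw [pow_two, h1]
  let u : sphereBundle g 1 := ⟨⟨p, (1 / √(g.inner p X X)) • X⟩, hmem⟩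
  -- A linear form on a space of dimension at least 2 has a nonzero kernel vector.
  have hker : LinearMap.ker (flat g u.1) ≠ ⊥ :=
    LinearMap.ker_ne_bot_of_finrank_lt (by
      rw [Module.finrank_self]
      exact lt_of_lt_of_le one_lt_two hdim)
  obtain ⟨Y, hY, hY0⟩ := (Submodule.ne_bot_iff _).1 hker
  exact ⟨u, Y, hY0, (g.symm _ _ _).trans hY⟩

/-! ### The characteristic vectors -/

/-- On the vertical lift of u the two √a terms of J_A cancel. The remaining ε√(a + b) is reduced to
ε by the normalisation of the normal. -/
theorem baseVelocity_xiA (g : Metric E M) (P : Params) (u : sphereBundle g 1) :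
    baseVelocity u.1 (xiA g P u.1 : TT u.1) = -P.ε • u.1.snd := by
  have h0 : 0 < P.a (1 / 2) + P.b (1 / 2) := by
    have := P.a_add_pos (1 / 2) (by norm_num)
    norm_num at this ⊢
    exact this
  have h2 : √(P.a (1 / 2) + P.b (1 / 2)) ≠ 0 := (Real.sqrt_pos.2 h0).ne'
  change baseVelocity u.1 (-JA g P u.1 (unitNormal u.1 (metricA g P u.1))) = _
  rw [unitNormal_metricA, map_smul, map_neg, map_smul, baseVelocity_JA, connector_verticalLift,
    normSq_sphereBundle, one_pow, one_smul, ← add_smul, smul_smul, ← neg_smul]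
  congr 1
  field_simp
  ring

theorem connector_xiA (g : Metric E M) (P : Params) (u : sphereBundle g 1) :
    connector g u.1 (xiA g P u.1 : TT u.1) = 0 := by
  change connector g u.1 (-JA g P u.1 (unitNormal u.1 (metricA g P u.1))) = _
  rw [unitNormal_metricA, map_smul, map_neg, map_smul, connector_JA, baseVelocity_verticalLift,
    map_zero, zero_smul, smul_zero, smul_zero, sub_zero, smul_zero, neg_zero]

theorem baseVelocity_xiS (g : Metric E M) {r : ℝ} (hr : 0 < r) (v : sphereBundle g r) :
    baseVelocity v.1 (xiS g v.1 : TT v.1) = (1 / r) • v.1.snd := by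
  change baseVelocity v.1 (-sasakiJ g v.1 (unitNormal v.1 (sasakiMetric g v.1))) = _
  rw [unitNormal_sasaki g hr, map_smul, map_neg, map_smul, baseVelocity_sasakiJ,
    connector_verticalLift, smul_neg, neg_neg]

theorem connector_xiS (g : Metric E M) {r : ℝ} (hr : 0 < r) (v : sphereBundle g r) :
    connector g v.1 (xiS g v.1 : TT v.1) = 0 := by
  change connector g v.1 (-sasakiJ g v.1 (unitNormal v.1 (sasakiMetric g v.1))) = _
  rw [unitNormal_sasaki g hr, map_smul, map_neg, map_smul, connector_sasakiJ,
    baseVelocity_verticalLift, smul_zero, neg_zero]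

theorem dSphereMap_xiA (g : Metric E M) (P : Params) {r : ℝ} (hr : 0 < r)
    (u : sphereBundle g 1) :
    dSphereMap g r u (xiA g P u) = (-P.ε) • xiS g (sphereMap g r u) := by
  refine Subtype.ext (ext_baseVelocity_connector g ?_ ?_)
  · rw [baseVelocity_dSphereMap, baseVelocity_xiA, Submodule.coe_smul, map_smul,
      baseVelocity_xiS g hr (sphereMap g r u)]
    -- The base vector of ξ_r is ru, so its normalisation by 1/r gives back u.
    change _ = -P.ε • ((1 / r) • (r • u.1.snd))
    rw [smul_smul (1 / r), one_div_mul_cancel hr.ne', one_smul]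
  · rw [connector_dSphereMap, connector_xiA, Submodule.coe_smul, map_smul,
      connector_xiS g hr (sphereMap g r u), smul_zero]
    exact (smul_zero (A := T E u.1.proj) (-P.ε)).symm

theorem dSphereMap_contactXiA (g : Metric E M) (P : Params) (u : sphereBundle g 1) :
    dSphereMap g √(P.a (1 / 2)) u (contactXiA g P u) =
      contactXiS g √(P.a (1 / 2)) (sphereMap g √(P.a (1 / 2)) u) := by
  have hr : 0 < √(P.a (1 / 2)) := Real.sqrt_pos.2 (P.a_pos _ (by norm_num))
  rw [contactXiA, contactXiS, map_smul, dSphereMap_xiA g P hr, smul_smul]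
  congr 1
  -- The coefficient is (-2ε√a)(-ε) = 2√a, since ε² = 1.
  rcases P.ε_eq with h | h <;> rw [h] <;> ring

end

end TangentSphere

theorem theorem3p4 {E : Type*} [NormedAddCommGroup E] [NormedSpace ℝ E] [FiniteDimensional ℝ E]
    (hdim : 2 ≤ Module.finrank ℝ E)
    {M : Type*} [TopologicalSpace M] [ChartedSpace E M] [IsManifold 𝓘(ℝ, E) ∞ M] [Nonempty M]
    (g : TangentSphere.Metric E M) (P : TangentSphere.Params) (r : ℝ) (hr : 0 < r) :
    ((∀ u : TangentSphere.sphereBundle g 1,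
        TangentSphere.dSphereMap g r u ∘ₗ TangentSphere.phiA g P u =
          TangentSphere.phiS g (TangentSphere.sphereMap g r u) ∘ₗ TangentSphere.dSphereMap g r u) ↔
      r = √(P.a (1 / 2))) ∧
    (∀ u : TangentSphere.sphereBundle g 1,
      TangentSphere.dSphereMap g r u (TangentSphere.xiA g P u) =
        (-P.ε) • TangentSphere.xiS g (TangentSphere.sphereMap g r u)) ∧
    (r = √(P.a (1 / 2)) → ∀ u : TangentSphere.sphereBundle g 1,
      TangentSphere.dSphereMap g r u (TangentSphere.contactXiA g P u) =
        TangentSphere.contactXiS g r (TangentSphere.sphereMap g r u)) := by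
  refine ⟨⟨fun h ↦ ?_, ?_⟩, TangentSphere.dSphereMap_xiA g P hr, ?_⟩
  · obtain ⟨u, Y, hY, hYu⟩ := TangentSphere.exists_sphereBundle_one_orthogonal hdim g
    exact TangentSphere.eq_of_dSphereMap_phiA (h u) hY hYu
  · rintro rfl
    exact TangentSphere.dSphereMap_phiA g P
  · rintro rfl
    exact TangentSphere.dSphereMap_contactXiA g P
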